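/- Let $F$ be a function field in one variable over the finite field $\mathbb F_q$ of characteristic $p$, let $\mathfrak p_\infty$ be a place of $F$, and let $A\subseteq F$ be the ring of functions regular at every place other than $\mathfrak p_\infty$. Assume that the class number $h_A$ of $A$ is $1$. For $a\in A\setminus\{0\}$ put $\deg a=\dim_{\mathbb F_q}A/aA$. Let $K$ be a finite extension of $F$ and let $\rho\colon A\to K\langle\tau\rangle$ be a Drinfeld $A$-module of rank one over $K$ (so $\deg_\tau\rho_a=\deg a$ for $a\neq 0$) whose structural map is the natural embedding $A\to K$. For a finite extension $L/K$ let $$\mu(L)=\{u\in L:\rho_a(u)=0\text{ for some }a\in A\setminus\{0\}\},\qquad \rho[a]=\{u\in\bar L:\rho_a(u)=0\},$$ $$\operatorname{DrinT}(L/K)=\{u\in L:\rho_m(u)\in K\text{ for some }m\in A\setminus\{0\}\},\qquad \operatorname{Drincog}(L/K)=\operatorname{DrinT}(L/K)/K,$$ the last being the Drinfeld cogalois module, where $A$ acts on $L$ through $\rho$. The extension $L/K$ is radical if $L=K(X)$ for some $X\subseteq\operatorname{DrinT}(L/K)$; it is pure if, for every irreducible $m\in A$, every generator of the $A$-module $\rho[m]$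 that lies in $L$ lies in $K$; it is cyclotomic coradical if it is radical, separable and pure. Let $L/K$ be a finite Galois cyclotomic coradical extension with $L=K(\mu(L))$ and put $G=\operatorname{Gal}(L/K)$. Then $\mu(L)=\rho[a]$ for some $a\in A\setminus\{0\}$, and $|G|=p^m$ for some integer $m\geq 0$. For every such $a$ and $m$, writing $\deg(\mu(L))=\deg a$, the module $\operatorname{Drincog}(L/K)$ is finite and $$|\operatorname{Drincog}(L/K)|\leq q^{m\deg(\mu(L))}.$$ -/

import Mathlib

open Polynomial

noncomputable section

namespace DrinfeldCogalois

/-- A place of a field `F` over a constant field `k`: a valuation ring `k ⊆ O ⊊ F` of `F`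
(in a function field in one variable every such ring is a discrete valuation ring). -/
structure Place (k F : Type*) [Field k] [Field F] [Algebra k F] where
  valRing : ValuationSubring F
  const_mem : ∀ c : k, algebraMap k F c ∈ valRing
  ne_top : valRing ≠ ⊤

/-- The ring `A` of all functions in `F` that are regular at every place different from `P`. -/
def regularRing {k F : Type*} [Field k] [Field F] [Algebra k F] (P : Place k F) :
    Subalgebra k F where
  carrier := {x | ∀ Q : Place k F, Q ≠ P → x ∈ Q.valRing}
  mul_mem' hx hy Q hQ := mul_mem (hx Q hQ) (hy Q hQ)
  add_mem' hx hy Q hQ := add_mem (hx Q hQ) (hy Q hQ)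
  algebraMap_mem' c Q _ := Q.const_mem c

/-- The degree of a nonzero element `a` of `A`: the `k`-dimension of `A / aA`. -/
def deg {k F : Type*} [Field k] [Field F] [Algebra k F] {P : Place k F}
    (a : regularRing P) : ℕ :=
  Module.finrank k (regularRing P ⧸ Ideal.span {a})

/-- A Drinfeld `A`-module over an extension `K` of `F`, whose structural map is the natural
embedding `A → K`: a homomorphism of `k`-algebras `a ↦ ρ_a` from `A` to the twisted polynomial
ring `K⟨τ⟩`, with constant term `ρ_a = a + ⋯` and with image not contained in `K`.
The ring `K⟨τ⟩` is realized as usual as the ring of `k`-linear polynomials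
`∑ c_i X ^ (q ^ i)`, with `q = |k|`, under addition and composition (`τ ^ i` is `X ^ (q ^ i)`). -/
structure DrinfeldModule {k F : Type*} [Field k] [Fintype k] [Field F] [Algebra k F]
    (P : Place k F) (K : Type*) [Field K] [Algebra F K] where
  toPoly : regularRing P → K[X]
  linear : ∀ a n, (toPoly a).coeff n ≠ 0 → ∃ i : ℕ, n = Fintype.card k ^ i
  map_add : ∀ a b, toPoly (a + b) = toPoly a + toPoly b
  map_mul : ∀ a b, toPoly (a * b) = (toPoly a).comp (toPoly b)
  map_const : ∀ c : k, toPoly (algebraMap k (regularRing P) c) =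
    C (algebraMap F K (algebraMap k F c)) * X
  coeff_one : ∀ a, (toPoly a).coeff 1 = algebraMap F K (a : F)
  nontrivial : ∃ a, toPoly a ≠ C (algebraMap F K (a : F)) * X

section lemmas

variable {k : Type*} [Field k] [Fintype k]

theorem eval_add_of_linear {L : Type*} [Field L] (φ : k →+* L) (f : L[X])
    (hf : ∀ n, f.coeff n ≠ 0 → ∃ i : ℕ, n = Fintype.card k ^ i) (x y : L) :
    f.eval (x + y) = f.eval x + f.eval y := by
  obtain ⟨p, hp⟩ := CharP.exists k
  have := hp
  obtain ⟨n, hprime, hcard⟩ := FiniteField.card k p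
  have : Fact p.Prime := ⟨hprime⟩
  have : CharP L p := charP_of_injective_ringHom φ.injective p
  simp only [Polynomial.eval_eq_sum, Polynomial.sum_def, ← Finset.sum_add_distrib]
  refine Finset.sum_congr rfl fun j hj => ?_
  obtain ⟨i, rfl⟩ := hf j (Polynomial.mem_support_iff.mp hj)
  rw [hcard, ← pow_mul, add_pow_char_pow, mul_add]

end lemmas

namespace DrinfeldModule

variable {k F : Type*} [Field k] [Fintype k] [Field F] [Algebra k F] {P : Place k F}
  {K : Type*} [Field K] [Algebra F K] (ρ : DrinfeldModule P K)

/-- `ρ` has rank one: for every nonzero `a`, the degree of `ρ_a` in `τ` is `deg a`. -/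
def IsRankOne : Prop :=
  ∀ a : regularRing P, a ≠ 0 → (ρ.toPoly a).natDegree = Fintype.card k ^ deg a

theorem aeval_add {L : Type*} [Field L] [Algebra K L] (a : regularRing P) (x y : L) :
    aeval (x + y) (ρ.toPoly a) = aeval x (ρ.toPoly a) + aeval y (ρ.toPoly a) := by
  have h := eval_add_of_linear (k := k)
    ((algebraMap K L).comp ((algebraMap F K).comp (algebraMap k F)))
    ((ρ.toPoly a).map (algebraMap K L)) (fun n hn => ρ.linear a n (by
      intro h0
      exact hn (by rw [Polynomial.coeff_map, h0, _root_.map_zero]))) x y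
  simpa only [Polynomial.eval_map_algebraMap] using h

theorem toPoly_zero : ρ.toPoly 0 = 0 := by
  have h := ρ.map_add 0 0
  rwa [add_zero, left_eq_add] at h

theorem toPoly_one : ρ.toPoly 1 = X := by
  have h := ρ.map_const 1
  rwa [_root_.map_one, _root_.map_one, _root_.map_one, Polynomial.C_1, one_mul] at h

theorem aeval_zero' {L : Type*} [Field L] [Algebra K L] (a : regularRing P) :
    aeval (0 : L) (ρ.toPoly a) = 0 := by
  have h := ρ.aeval_add a (0 : L) 0
  rwa [add_zero, left_eq_add] at h

/-- The additive group of an extension `L` of `K`, to be endowed with the `A`-module structure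
given by `ρ`. -/
@[nolint unusedArguments]
def Points (_ρ : DrinfeldModule P K) (L : Type*) [Field L] [Algebra K L] : Type _ := L

variable (L : Type*) [Field L] [Algebra K L]

instance : AddCommGroup (ρ.Points L) := inferInstanceAs (AddCommGroup L)

/-- The action `a • u = ρ_a(u)` of `A` on `L`. -/
instance : Module (regularRing P) (ρ.Points L) where
  smul a u := (aeval (show L from u) (ρ.toPoly a) : L)
  one_smul u := by
    change aeval (show L from u) (ρ.toPoly 1) = u
    rw [ρ.toPoly_one, Polynomial.aeval_X]
  mul_smul a b u := by
    change aeval (show L from u) (ρ.toPoly (a * b)) =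
      aeval (aeval (show L from u) (ρ.toPoly b)) (ρ.toPoly a)
    rw [ρ.map_mul, Polynomial.aeval_comp]
  smul_zero a := ρ.aeval_zero' (L := L) a
  smul_add a u v := ρ.aeval_add (L := L) a u v
  add_smul a b u := by
    change aeval (show L from u) (ρ.toPoly (a + b)) =
      aeval (show L from u) (ρ.toPoly a) + aeval (show L from u) (ρ.toPoly b)
    rw [ρ.map_add, _root_.map_add]
  zero_smul u := by
    change aeval (show L from u) (ρ.toPoly 0) = 0
    rw [ρ.toPoly_zero, _root_.map_zero]

/-- The torsion `μ(L)` of `ρ` in `L`. -/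
def torsion : Set L := {u | ∃ a : regularRing P, a ≠ 0 ∧ aeval u (ρ.toPoly a) = 0}

/-- The set `ρ[a]` of roots of `ρ_a` in an extension `Ω` of `K` (an algebraic closure,
in the applications). -/
def kernel (Ω : Type*) [Field Ω] [Algebra K Ω] (a : regularRing P) : Set Ω :=
  {u | aeval u (ρ.toPoly a) = 0}

/-- `μ(L) = ρ[a]`, as subsets of an algebraic closure of `L`. -/
def TorsionEqKernel (a : regularRing P) : Prop :=
  algebraMap L (AlgebraicClosure L) '' ρ.torsion L = ρ.kernel (AlgebraicClosure L) a

/-- `u` (an element `λ_a` of `L`) generates the `A`-module `ρ[a]`. -/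
def IsGenerator (a : regularRing P) (u : L) : Prop :=
  ρ.kernel (AlgebraicClosure L) a =
    Set.range fun c : regularRing P => algebraMap L (AlgebraicClosure L) (aeval u (ρ.toPoly c))

/-- `K` as an `A`-submodule of `L`. -/
def base : Submodule (regularRing P) (ρ.Points L) where
  carrier := {u | ∃ x : K, algebraMap K L x = (show L from u)}
  add_mem' := by
    rintro u v ⟨x, hx⟩ ⟨y, hy⟩
    refine ⟨x + y, ?_⟩
    rw [_root_.map_add, hx, hy]
    rfl
  zero_mem' := ⟨0, _root_.map_zero _⟩
  smul_mem' := by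
    rintro a u ⟨x, hx⟩
    refine ⟨aeval x (ρ.toPoly a), ?_⟩
    rw [← Polynomial.aeval_algebraMap_apply, hx]
    rfl

theorem mem_base_of_smul {a b : regularRing P} {u : ρ.Points L} (h : a • u ∈ ρ.base L) :
    (b * a) • u ∈ ρ.base L := by
  rw [mul_smul]
  exact Submodule.smul_mem _ _ h

/-- `DrinT(L/K)`: the `u ∈ L` such that `ρ_m(u) ∈ K` for some nonzero `m ∈ A`. -/
def drinT : Submodule (regularRing P) (ρ.Points L) where
  carrier := {u | ∃ m : regularRing P, m ≠ 0 ∧ m • u ∈ ρ.base L}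
  add_mem' := by
    rintro u v ⟨m, hm, hu⟩ ⟨n, hn, hv⟩
    refine ⟨m * n, mul_ne_zero hm hn, ?_⟩
    rw [smul_add]
    refine Submodule.add_mem _ ?_ (ρ.mem_base_of_smul L hv)
    rw [mul_comm]
    exact ρ.mem_base_of_smul L hu
  zero_mem' := ⟨1, one_ne_zero, by rw [smul_zero]; exact Submodule.zero_mem _⟩
  smul_mem' := by
    rintro b u ⟨m, hm, hu⟩
    refine ⟨m, hm, ?_⟩
    rw [← mul_smul, mul_comm]
    exact ρ.mem_base_of_smul L hu

/-- The Drinfeld cogalois module `Drincog(L/K) = DrinT(L/K) / K`. -/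
abbrev Drincog : Type _ := ρ.drinT L ⧸ (ρ.base L).submoduleOf (ρ.drinT L)

/-- `L/K` is radical: `L = K(X)` for some `X ⊆ DrinT(L/K)`. -/
def IsRadical : Prop :=
  ∃ X : Set L, (∀ u ∈ X, (show ρ.Points L from u) ∈ ρ.drinT L) ∧ IntermediateField.adjoin K X = ⊤

/-- `L/K` is pure: for every irreducible `m ∈ A`, every generator `λ_m` of `ρ[m]` that lies in
`L` lies in `K`. -/
def IsPure : Prop :=
  ∀ m : regularRing P, Irreducible m → ∀ u : L, ρ.IsGenerator L m u → ∃ x : K, algebraMap K L x = u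

/-- `L/K` is a cyclotomic coradical extension: radical, separable and pure. -/
def IsCyclotomicCoradical : Prop :=
  ρ.IsRadical L ∧ Algebra.IsSeparable K L ∧ ρ.IsPure L

end DrinfeldModule

end DrinfeldCogalois

end

/-! Any `a ≠ 0` of degree zero is a unit, so rank one forces all quotients `A/aA` to be finite of
order `q ^ deg a`. Since `A` is an intersection of valuation rings it is Dedekind, and class number
one makes it a PID. The torsion `μ(L)` is finite (`finite_torsion`): at a place where a
transcendental `t ∈ A` is small, `ρ_t` expands large points and contracts small ones, so points with
finite orbits are bounded and discrete.

A finite torsion module over a PID contains an `x` whose annihilator `aA` is that of the whole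
module. Since `|ρ[a]| ≤ q ^ deg a = |A/aA|`, the point `x` generates `ρ[a]`, whence `μ(L) = ρ[a] = A
x` (`exists_generator_torsion`).

An automorphism `σ` acts on `μ(L)` as some `c ∈ A`. Purity says that `σ` fixes a generator of `ρ[m]`
for each irreducible `m ∣ a`, so `m ∣ c - 1`. Then `c - 1` is nilpotent modulo `a`, and in
characteristic `p` some `c ^ p ^ j` is `1` modulo `a`. As `L` is generated by torsion, `σ` has
`p`-power order (`exists_pow_ringChar_eq_one`).

Finally `u ↦ (σ u - u)`, for `σ` in a generating set of `G`, embeds the cogalois module into a power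
of `μ(L)` (`card_drincog_le`), and `m` generators suffice when `|G| = p ^ m`. -/

namespace DrinfeldCogalois

/-! ### Function fields in one variable, and finiteness of points with finite orbits -/

section FunctionFields

variable {k L : Type*} [Field k] [Field L] [Algebra k L]

/-- A function field in one variable over `k` is finite over `k(t)` for every transcendental `t`. -/
theorem finiteDimensional_adjoin_of_transcendental [Algebra (RatFunc k) L]
    [IsScalarTower k (RatFunc k) L] [FiniteDimensional (RatFunc k) L] {t : L}
    (ht : Transcendental k t) : FiniteDimensional (IntermediateField.adjoin k {t}) L := by
  let : Algebra k[X] L := ((algebraMap (RatFunc k) L).comp (algebraMap k[X] (RatFunc k))).toAlgebra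
  have : IsScalarTower k[X] (RatFunc k) L := IsScalarTower.of_algebraMap_eq' rfl
  have : IsScalarTower k k[X] L := IsScalarTower.of_algebraMap_eq' (by
    rw [IsScalarTower.algebraMap_eq k (RatFunc k) L, IsScalarTower.algebraMap_eq k k[X] (RatFunc k),
      IsScalarTower.algebraMap_eq k[X] (RatFunc k) L, RingHom.comp_assoc])
  have : Algebra.IsAlgebraic k[X] L :=
    (IsFractionRing.comap_isAlgebraic_iff (K := RatFunc k)).mpr inferInstance
  have : FaithfulSMul k[X] L := (faithfulSMul_iff_algebraMap_injective _ _).mpr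
    ((algebraMap (RatFunc k) L).injective.comp (IsFractionRing.injective k[X] (RatFunc k)))
  have hX : IsTranscendenceBasis k (algebraMap k[X] L ∘ fun _ : Unit => (X : k[X])) :=
    (IsTranscendenceBasis.polynomial Unit k).algebraMap_comp
  have htr := hX.lift_cardinalMk_eq_trdeg
  have hti : AlgebraicIndependent k fun _ : Unit => t :=
    (algebraicIndependent_unique_type_iff (ι := Unit)).mpr ht
  -- The transcendence degree is one, as `X` shows, so a single transcendental element is already a
  -- basis.
  have hb : IsTranscendenceBasis k fun _ : Unit => t :=
    hti.isTranscendenceBasis_of_lift_trdeg_le_of_finite htr.ge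
  have halg := hb.isAlgebraic_field
  rw [Set.range_const] at halg
  have : Algebra.EssFiniteType k (RatFunc k) :=
    have : Algebra.EssFiniteType k[X] (RatFunc k) := .of_isLocalization _ (nonZeroDivisors k[X])
    .comp k k[X] (RatFunc k)
  have : Algebra.EssFiniteType k L := .comp k (RatFunc k) L
  have : Algebra.EssFiniteType (IntermediateField.adjoin k {t}) L := .of_comp k _ _
  exact Algebra.finite_of_essFiniteType_of_isAlgebraic

theorem exists_aeval_eq_of_mem_adjoin {t x : L} (hx : x ∈ Algebra.adjoin k {t}) :
    ∃ p : k[X], aeval t p = x := by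
  rwa [Algebra.adjoin_singleton_eq_range_aeval] at hx

variable {S : Subalgebra k L} {t : S}

/-- Modulo `t` only the constant coefficients survive, and independence of the residues kills them.
The relation can then be divided by `t`, and one repeats. -/
theorem X_pow_dvd_of_sum_eq_zero (ht : t ≠ 0) {ι : Type*} [Fintype ι] {y : ι → S}
    (hy : LinearIndependent k fun i => Ideal.Quotient.mk (Ideal.span {t}) (y i)) (n : ℕ) :
    ∀ p : ι → k[X], ∑ i, aeval t (p i) * y i = 0 → ∀ i, X ^ n ∣ p i := by
  induction n with
  | zero => simp
  | succ n ih =>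
    intro p hp
    have hsplit : ∀ i, aeval t (p i) =
        t * aeval t (p i).divX + algebraMap k S ((p i).coeff 0) := fun i => by
      conv_lhs => rw [← X_mul_divX_add (p i), _root_.map_add, _root_.map_mul, aeval_X, aeval_C]
    have hsum : t * ∑ i, aeval t (p i).divX * y i + ∑ i, (p i).coeff 0 • y i = 0 := by
      rw [← hp, Finset.mul_sum, ← Finset.sum_add_distrib]
      refine Finset.sum_congr rfl fun i _ => ?_
      rw [hsplit, Algebra.smul_def]
      ring
    have hcoeff : ∀ i, (p i).coeff 0 = 0 := by
      refine Fintype.linearIndependent_iff.mp hy _ ?_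
      have h := congr(Ideal.Quotient.mkₐ k (Ideal.span {t}) $hsum)
      have ht0 : Ideal.Quotient.mkₐ k (Ideal.span {t}) t = 0 :=
        Ideal.Quotient.eq_zero_iff_mem.mpr (Ideal.mem_span_singleton_self t)
      rw [_root_.map_add, _root_.map_mul, ht0, zero_mul, zero_add, map_sum, _root_.map_zero] at h
      simp only [map_smul] at h
      exact h
    simp only [hcoeff, zero_smul, Finset.sum_const_zero, add_zero, mul_eq_zero, ht,
      false_or] at hsum
    intro i
    have h := mul_dvd_mul_left X (ih _ hsum i)
    rw [← X_mul_divX_add (p i), hcoeff, C_0, add_zero, pow_succ']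
    exact h

open scoped IntermediateField.algebraAdjoinAdjoin in
/-- Reduction modulo `t` of a subring of a finite extension of `k(t)` gives a finite-dimensional
algebra. -/
theorem finite_quotient_span_of_finiteDimensional_adjoin (ht : t ≠ 0)
    [FiniteDimensional (IntermediateField.adjoin k {(t : L)}) L] :
    Module.Finite k (S ⧸ Ideal.span {t}) := by
  have : Module.Free k (S ⧸ Ideal.span {t}) := Module.Free.of_divisionRing _ _
  let E := IntermediateField.adjoin k {(t : L)}
  -- Lifts of independent residues are independent over `k[t]`, hence over its fraction field
  -- `k(t)`.
  have hrank : Module.rank k (S ⧸ Ideal.span {t}) ≤ Module.finrank E L := by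
    refine rank_le fun s hs => ?_
    choose y hy using fun x : s => Ideal.Quotient.mk_surjective (x : S ⧸ Ideal.span {t})
    have hs' : LinearIndependent k fun i => Ideal.Quotient.mk (Ideal.span {t}) (y i) := by
      simpa only [hy] using hs
    have hD : LinearIndependent (Algebra.adjoin k {(t : L)}) fun i => (y i : L) := by
      refine Fintype.linearIndependent_iff.mpr fun g hg => ?_
      have hex : ∀ i, ∃ p, aeval (t : L) p = g i := fun i =>
        exists_aeval_eq_of_mem_adjoin (g i).2
      choose p hp' using hex
      have hsum : ∑ i, aeval t (p i) * y i = 0 := by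
        apply Subtype.val_injective
        have : ∀ i, ((aeval t (p i) : S) : L) = g i := fun i => by
          rw [← hp', ← Subalgebra.coe_val, ← aeval_algHom_apply]
        change ((∑ i, aeval t (p i) * y i : S) : L) = 0
        rw [AddSubmonoidClass.coe_finsetSum, ← hg]
        refine Finset.sum_congr rfl fun i _ => ?_
        rw [MulMemClass.coe_mul, this]
        rfl
      intro i
      apply Subtype.val_injective
      -- Divisibility by a power of `X` exceeding the degree kills the leading coefficient.
      have h0 : p i = 0 := by
        by_contra h
        have := (X_pow_dvd_iff.mp (X_pow_dvd_of_sum_eq_zero ht hs' ((p i).natDegree + 1) p hsum i))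
          (p i).natDegree (Nat.lt_succ_self _)
        exact h (leadingCoeff_eq_zero.mp this)
      rw [← hp', h0, _root_.map_zero]
      rfl
    have hE := (LinearIndependent.iff_fractionRing (Algebra.adjoin k {(t : L)}) E).mp hD
    rw [← Fintype.card_coe s]
    exact LinearIndependent.fintype_card_le_finrank hE
  exact Module.rank_lt_aleph0_iff.mp (hrank.trans_lt (Cardinal.natCast_lt_aleph0))

/-- For every transcendental `t` there is a valuation ring containing `k` in which `t` is a nonzero
nonunit. -/
theorem exists_valuationSubring_of_transcendental {t : L} (ht : Transcendental k t) :
    ∃ O : ValuationSubring L, (∀ c : k, algebraMap k L c ∈ O) ∧ O.valuation t < 1 := by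
  set D := (Algebra.adjoin k {t}).toSubring
  have htD : t ∈ D := Algebra.subset_adjoin rfl
  have hI : Ideal.span {(⟨t, htD⟩ : D)} ≠ ⊤ := by
    rw [Ne, Ideal.span_singleton_eq_top]
    intro hu
    obtain ⟨⟨b, hb⟩, hmul⟩ := hu.exists_right_inv
    have hb' : b ∈ Algebra.adjoin k {t} := hb
    rw [Algebra.adjoin_singleton_eq_range_aeval] at hb'
    obtain ⟨p, rfl⟩ := hb'
    have h1 : t * aeval t p = 1 := congrArg Subtype.val hmul
    have h2 : aeval t (X * p - 1) = 0 := by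
      rw [_root_.map_sub, _root_.map_mul, aeval_X, _root_.map_one, h1, sub_self]
    have h3 := (transcendental_iff.mp ht) _ h2
    have := congrArg (eval 0) h3
    simp at this
  obtain ⟨O, hDO, hspan⟩ := Ideal.image_subset_nonunits_valuationSubring _ hI
  refine ⟨O, fun c => hDO ((Algebra.adjoin k {t}).algebraMap_mem c), ?_⟩
  exact O.mem_nonunits_iff.mp (hspan ⟨_, Ideal.mem_span_singleton_self _, rfl⟩)

/-- Factor out the largest power of `X`: the cofactor has a nonzero constant term, a unit of `O`,
which dominates its other terms. -/
theorem valuation_aeval_eq_pow {O : ValuationSubring L} (hk : ∀ c : k, algebraMap k L c ∈ O)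
    {t : L} (ht : O.valuation t < 1) {p : k[X]} (hp : p ≠ 0) :
    ∃ n : ℕ, O.valuation (aeval t p) = O.valuation t ^ n := by
  have htO : t ∈ O := O.valuation_le_one_iff t |>.mp ht.le
  have hmem : ∀ q : k[X], aeval t q ∈ O := fun q => by
    rw [aeval_eq_sum_range]
    exact sum_mem fun i _ => by
      rw [Algebra.smul_def]
      exact mul_mem (hk _) (pow_mem htO _)
  obtain ⟨q, hq, hq0⟩ := exists_eq_pow_rootMultiplicity_mul_and_not_dvd p hp 0
  rw [C_0, sub_zero] at hq hq0
  refine ⟨p.rootMultiplicity 0, ?_⟩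
  have hc : q.coeff 0 ≠ 0 := fun h => hq0 (X_dvd_iff.mpr h)
  have hone : O.valuation (algebraMap k L (q.coeff 0)) = 1 := by
    refine le_antisymm ((O.valuation_le_one_iff _).mpr (hk _)) ?_
    have h := (O.valuation_le_one_iff _).mpr (hk (q.coeff 0)⁻¹)
    rw [map_inv₀, map_inv₀] at h
    exact (inv_le_one₀ (zero_lt_iff.mpr (by simpa using hc))).mp h
  have hunit : O.valuation (aeval t q) = 1 := by
    rw [← X_mul_divX_add q, _root_.map_add, _root_.map_mul, aeval_X, aeval_C, ← hone]
    refine Valuation.map_add_eq_of_lt_right _ ?_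
    rw [_root_.map_mul, hone]
    exact mul_lt_one_of_lt_of_le ht ((O.valuation_le_one_iff _).mpr (hmem _))
  conv_lhs => rw [hq]
  rw [_root_.map_mul, map_pow, aeval_X, _root_.map_mul, map_pow, hunit, mul_one]

/-- If `L` is algebraic over `k(t)` then the valuation rings of `L / k` in which `t` is a nonunit
have rank one. -/
theorem exists_pow_mul_mem_of_isAlgebraic {O : ValuationSubring L}
    (hk : ∀ c : k, algebraMap k L c ∈ O) {t : L} (ht0 : t ≠ 0) (ht : O.valuation t < 1)
    [Algebra.IsAlgebraic (IntermediateField.adjoin k {t}) L] (x : L) :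
    ∃ n : ℕ, O.valuation t ^ n * O.valuation x ≤ 1 := by
  by_contra! hx
  have hx0 : x ≠ 0 := by
    rintro rfl
    simpa using hx 0
  have hτ : O.valuation t ≠ 0 := (Valuation.ne_zero_iff _).mpr ht0
  open scoped IntermediateField.algebraAdjoinAdjoin in
  -- If `x` were larger than every power of `t⁻¹`, then `x⁻¹` would be smaller than every power of
  -- `t`. But `x⁻¹` bounds the nonzero constant term of an equation for itself over `k[t]`, whose
  -- valuation is a power of that of `t`.
  have halg : IsAlgebraic (Algebra.adjoin k {t}) x⁻¹ :=
    (IsFractionRing.isAlgebraic_iff (Algebra.adjoin k {t}) (IntermediateField.adjoin k {t}) L).mpr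
      (Algebra.IsAlgebraic.isAlgebraic _)
  obtain ⟨f, hf0, hf⟩ := halg.exists_nonzero_coeff_and_aeval_eq_zero
    (mem_nonZeroDivisors_of_ne_zero (inv_ne_zero hx0))
  have hrep : ∀ d : Algebra.adjoin k {t}, ∃ p, aeval t p = (d : L) := fun d =>
    exists_aeval_eq_of_mem_adjoin d.2
  have hle : ∀ d : Algebra.adjoin k {t}, O.valuation (d : L) ≤ 1 := fun d => by
    obtain ⟨p, hp⟩ := hrep d
    rw [← hp]
    rcases eq_or_ne p 0 with rfl | hp0
    · simp
    · obtain ⟨n, hn⟩ := valuation_aeval_eq_pow hk ht hp0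
      rw [hn]
      exact pow_le_one₀ zero_le ht.le
  obtain ⟨p, hp⟩ := hrep (f.coeff 0)
  have hp0 : p ≠ 0 := by
    rintro rfl
    exact hf0 (Subtype.val_injective (by simpa using hp.symm))
  obtain ⟨n, hn⟩ := valuation_aeval_eq_pow hk ht hp0
  have hxinv : O.valuation x⁻¹ < O.valuation t ^ (n + 1) := by
    rw [map_inv₀]
    exact (inv_lt_iff_one_lt_mul₀ (zero_lt_iff.mpr (by simpa using hx0))).mpr (hx _)
  have hsmall : O.valuation (aeval t p) ≤ O.valuation x⁻¹ := by
    have h : (f.coeff 0 : L) = -(x⁻¹ * aeval x⁻¹ f.divX) := by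
      rw [← X_mul_divX_add f] at hf
      simp only [_root_.map_add, _root_.map_mul, aeval_X, aeval_C] at hf
      exact eq_neg_of_add_eq_zero_right hf
    rw [hp, h, Valuation.map_neg, _root_.map_mul, aeval_eq_sum_range]
    refine mul_le_of_le_one_right' (Valuation.map_sum_le _ fun i _ => ?_)
    rw [Algebra.smul_def, _root_.map_mul, map_pow]
    refine mul_le_one' (hle _) (pow_le_one₀ zero_le ?_)
    exact hxinv.le.trans (pow_le_one₀ zero_le ht.le)
  rw [hn] at hsmall
  have := hsmall.trans_lt hxinv
  exact absurd (pow_lt_pow_iff_right_of_lt_one₀ (zero_lt_iff.mpr hτ) ht |>.mp this) (by omega)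

theorem exists_pow_mul_le_one {O : ValuationSubring L} {t : L} (ht : O.valuation t < 1)
    (harch : ∀ x : L, ∃ n : ℕ, O.valuation t ^ n * O.valuation x ≤ 1) (s : Finset L) :
    ∃ n : ℕ, ∀ x ∈ s, O.valuation t ^ n * O.valuation x ≤ 1 := by
  choose n hn using harch
  refine ⟨s.sup n, fun x hx => le_trans ?_ (hn x)⟩
  exact mul_le_mul_left (pow_le_pow_of_le_one zero_le ht.le (Finset.le_sup hx)) _

/-- A polynomial of degree at least two is expanding near infinity. -/
theorem exists_forall_valuation_lt_valuation_eval {O : ValuationSubring L} {t : L}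
    (ht : O.valuation t < 1)
    (harch : ∀ x : L, ∃ n : ℕ, O.valuation t ^ n * O.valuation x ≤ 1) {f : L[X]}
    (hdeg : 2 ≤ f.natDegree) :
    ∃ n : ℕ, ∀ u : L, 1 < O.valuation t ^ n * O.valuation u →
      O.valuation u < O.valuation (f.eval u) := by
  have hf : f.leadingCoeff ≠ 0 := fun h => by
    rw [leadingCoeff_eq_zero.mp h] at hdeg
    simp at hdeg
  classical
  -- The ratios make the leading term dominate for large `u`; the inverse of the leading coefficient
  -- makes that term larger than `u`.
  obtain ⟨n, hn⟩ := exists_pow_mul_le_one ht harch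
    (insert f.leadingCoeff⁻¹ ((Finset.range f.natDegree).image fun j => f.coeff j / f.leadingCoeff))
  have hc : 0 < O.valuation f.leadingCoeff := zero_lt_iff.mpr (by simpa using hf)
  have hn1 := hn _ (Finset.mem_insert_self _ _)
  have hn2 : ∀ j < f.natDegree,
      O.valuation t ^ n * O.valuation (f.coeff j) ≤ O.valuation f.leadingCoeff := fun j hj => by
    have := hn _ (Finset.mem_insert_of_mem
      (Finset.mem_image_of_mem _ (Finset.mem_range.mpr hj)))
    rwa [map_div₀, mul_div_assoc', div_le_one₀ hc] at this
  rw [map_inv₀, ← div_eq_mul_inv, div_le_one₀ hc] at hn1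
  refine ⟨n, fun u hu => ?_⟩
  have hτ : O.valuation t ^ n ≤ 1 := pow_le_one₀ zero_le ht.le
  have hu1 : 1 < O.valuation u := hu.trans_le (mul_le_of_le_one_left' hτ)
  have hu0 : 0 < O.valuation u := zero_lt_one.trans hu1
  have hlow : O.valuation (∑ j ∈ Finset.range f.natDegree, f.coeff j * u ^ j) <
      O.valuation (f.coeff f.natDegree * u ^ f.natDegree) := by
    refine Valuation.map_sum_lt' _ ?_ fun j hj => ?_
    · rw [_root_.map_mul, map_pow]
      exact mul_pos hc (pow_pos hu0 _)
    · rw [_root_.map_mul, _root_.map_mul, map_pow, map_pow]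
      have hj' := Finset.mem_range.mp hj
      rcases eq_or_ne (f.coeff j) 0 with h0 | h0
      · rw [h0, _root_.map_zero, zero_mul]
        exact mul_pos hc (pow_pos hu0 _)
      have hj0 : 0 < O.valuation (f.coeff j) := zero_lt_iff.mpr (by simpa using h0)
      calc O.valuation (f.coeff j) * O.valuation u ^ j
          < O.valuation (f.coeff j) * O.valuation u ^ j * (O.valuation t ^ n * O.valuation u) :=
            lt_mul_of_one_lt_right (mul_pos hj0 (pow_pos hu0 _)) hu
        _ = O.valuation t ^ n * O.valuation (f.coeff j) * O.valuation u ^ (j + 1) := by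
            rw [pow_succ]; ac_rfl
        _ ≤ O.valuation f.leadingCoeff * O.valuation u ^ f.natDegree :=
            mul_le_mul' (hn2 j hj') (pow_le_pow_right₀ hu1.le hj')
  rw [eval_eq_sum_range, Finset.sum_range_succ, Valuation.map_add_eq_of_lt_right _ hlow,
    _root_.map_mul, map_pow]
  have h1 : 1 < O.valuation f.leadingCoeff * O.valuation u :=
    hu.trans_le (mul_le_mul_left hn1 _)
  calc O.valuation u < O.valuation f.leadingCoeff * O.valuation u * O.valuation u :=
        lt_mul_of_one_lt_left hu0 h1
    _ = O.valuation f.leadingCoeff * O.valuation u ^ 2 := by rw [sq, mul_assoc]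
    _ ≤ O.valuation f.leadingCoeff * O.valuation u ^ f.natDegree :=
        mul_le_mul_right (pow_le_pow_right₀ hu1.le hdeg) _

/-- A polynomial with constant term zero and linear term `t X` is multiplication by `t`, up to
units, near zero. -/
theorem exists_forall_valuation_eval_eq {O : ValuationSubring L} {t : L}
    (ht0 : t ≠ 0) (ht : O.valuation t < 1)
    (harch : ∀ x : L, ∃ n : ℕ, O.valuation t ^ n * O.valuation x ≤ 1) {f : L[X]}
    (hf0 : f.coeff 0 = 0) (hf1 : f.coeff 1 = t) :
    ∃ n : ℕ, ∀ u : L, O.valuation u ≤ O.valuation t ^ n →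
      O.valuation (f.eval u) = O.valuation t * O.valuation u := by
  classical
  obtain ⟨n, hn⟩ := exists_pow_mul_le_one ht harch
    ((Finset.range f.natDegree).image fun j => f.coeff (j + 2))
  have hτ : 0 < O.valuation t := zero_lt_iff.mpr (by simpa using ht0)
  -- The factor `t ^ n` absorbs the coefficients; of the two further factors, one matches the linear
  -- term `t u` and the other gives strict inequality.
  refine ⟨n + 2, fun u hu => ?_⟩
  rcases eq_or_ne u 0 with rfl | hu0
  · rw [← coeff_zero_eq_eval_zero, hf0, _root_.map_zero, mul_zero]
  have hv : 0 < O.valuation u := zero_lt_iff.mpr (by simpa using hu0)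
  have hu1 : O.valuation u ≤ 1 := hu.trans (pow_le_one₀ zero_le ht.le)
  have heval : f.eval u =
      ∑ j ∈ Finset.range f.natDegree, f.coeff (j + 2) * u ^ (j + 2) + t * u := by
    rw [eval_eq_sum_range' (n := f.natDegree + 2) (by omega), Finset.sum_range_succ',
      Finset.sum_range_succ', hf0, zero_add, hf1]
    simp
  rw [heval, ← _root_.map_mul]
  refine Valuation.map_add_eq_of_lt_right _ ?_
  rw [_root_.map_mul]
  refine Valuation.map_sum_lt' _ (mul_pos hτ hv) fun j hj => ?_
  have hj' := hn _ (Finset.mem_image_of_mem _ hj)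
  rw [_root_.map_mul, map_pow]
  calc O.valuation (f.coeff (j + 2)) * O.valuation u ^ (j + 2)
      ≤ O.valuation (f.coeff (j + 2)) * (O.valuation t ^ (n + 2) * O.valuation u) := by
        refine mul_le_mul_right ?_ _
        calc O.valuation u ^ (j + 2) ≤ O.valuation u ^ 2 :=
              pow_le_pow_of_le_one zero_le hu1 (by omega)
          _ ≤ _ := by rw [sq]; exact mul_le_mul_left hu _
    _ = O.valuation t ^ n * O.valuation (f.coeff (j + 2)) * O.valuation t *
          (O.valuation t * O.valuation u) := by rw [pow_add, sq]; ac_rfl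
    _ ≤ O.valuation t * (O.valuation t * O.valuation u) :=
        mul_le_mul_left (mul_le_of_le_one_left' hj') _
    _ < O.valuation t * O.valuation u := mul_lt_of_lt_one_left (mul_pos hτ hv) ht

/-- Used with a valuation for expansion near infinity, and with its order dual for contraction near
zero. -/
theorem infinite_range_iterate_of_lt {α β : Type*} [LinearOrder β] (v : α → β) (f : α → α)
    {s : Set α} (hs : ∀ x ∈ s, f x ∈ s ∧ v x < v (f x)) {x : α} (hx : x ∈ s) :
    (Set.range fun n => f^[n] x).Infinite := by
  have hmem : ∀ n, f^[n] x ∈ s := fun n => by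
    induction n with
    | zero => exact hx
    | succ n ih => rw [Function.iterate_succ_apply']; exact (hs _ ih).1
  have hmono : StrictMono fun n => v (f^[n] x) := strictMono_nat_of_lt_succ fun n => by
    rw [Function.iterate_succ_apply']
    exact (hs _ (hmem n)).2
  exact Set.infinite_range_of_injective fun a b hab => hmono.injective (congrArg v hab)

/-- In a function field over a finite field, an additive group of points with finite orbits under
a polynomial `t X + ⋯` of degree at least two, with `t` transcendental, is finite. -/
theorem finite_of_finite_orbits [Finite k] [Algebra (RatFunc k) L] [IsScalarTower k (RatFunc k) L]
    [FiniteDimensional (RatFunc k) L] {t : L} (ht : Transcendental k t) {f : L[X]}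
    (hdeg : 2 ≤ f.natDegree) (hf0 : f.coeff 0 = 0) (hf1 : f.coeff 1 = t) (H : AddSubgroup L)
    (hH : ∀ u ∈ H, (Set.range fun n => (fun x => f.eval x)^[n] u).Finite) : Finite H := by
  have hfin := finiteDimensional_adjoin_of_transcendental ht
  have ht0 : t ≠ 0 := fun h => ht (h ▸ isAlgebraic_zero)
  obtain ⟨O, hk, htO⟩ := exists_valuationSubring_of_transcendental ht
  have hτ : 0 < O.valuation t := zero_lt_iff.mpr (by simpa using ht0)
  have harch := exists_pow_mul_mem_of_isAlgebraic hk ht0 htO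
  obtain ⟨n, hn⟩ := exists_forall_valuation_lt_valuation_eval htO harch hdeg
  obtain ⟨N, hN⟩ := exists_forall_valuation_eval_eq ht0 htO harch hf0 hf1
  have hlarge : ∀ u ∈ H, O.valuation t ^ n * O.valuation u ≤ 1 := fun u hu => by
    by_contra! h
    refine infinite_range_iterate_of_lt O.valuation (fun x => f.eval x)
      (s := {x | 1 < O.valuation t ^ n * O.valuation x}) (fun x hx => ?_) h (hH u hu)
    exact ⟨lt_of_lt_of_le hx (mul_le_mul_right (hn x hx).le _), hn x hx⟩
  have hsmall : ∀ u ∈ H, O.valuation u ≤ O.valuation t ^ N → u = 0 := fun u hu h => by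
    by_contra hu0
    refine infinite_range_iterate_of_lt (OrderDual.toDual ∘ O.valuation) (fun x => f.eval x)
      (s := {x | x ≠ 0 ∧ O.valuation x ≤ O.valuation t ^ N}) (fun x hx => ?_) ⟨hu0, h⟩ (hH u hu)
    have hx0 : 0 < O.valuation x := zero_lt_iff.mpr (by simpa using hx.1)
    have hlt : O.valuation (f.eval x) < O.valuation x := by
      rw [hN x hx.2]
      exact mul_lt_of_lt_one_left hx0 htO
    refine ⟨⟨fun h0 => ?_, hlt.le.trans hx.2⟩, hlt⟩
    have := hN x hx.2
    rw [h0, _root_.map_zero] at this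
    exact (mul_pos hτ hx0).ne this
  let S : Subalgebra k L := { O.toSubring with algebraMap_mem' := hk }
  have hmemS : ∀ x : L, x ∈ S ↔ O.valuation x ≤ 1 := fun x => (O.valuation_le_one_iff x).symm
  let t' : S := ⟨t, (hmemS t).mpr htO.le⟩
  have hfin' : FiniteDimensional (IntermediateField.adjoin k {(t' : L)}) L := hfin
  have : Module.Finite k (S ⧸ Ideal.span {t'}) :=
    finite_quotient_span_of_finiteDimensional_adjoin fun h => ht0 (congrArg Subtype.val h)
  have : Finite (S ⧸ Ideal.span {t'}) := Module.finite_of_finite k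
  have : Finite (S ⧸ Ideal.span {t'} ^ (n + N)) :=
    Ideal.finite_quotient_pow (Submodule.fg_span_singleton _) _
  have hmul : ∀ u ∈ H, t ^ n * u ∈ S := fun u hu =>
    (hmemS _).mpr (by rw [_root_.map_mul, map_pow]; exact hlarge u hu)
  -- Boundedness puts `t ^ n * u` in `S`. Two points that agree modulo `t ^ (n + N)` differ by an
  -- element of `t ^ N S`, which is zero by `hsmall`.
  refine Finite.of_injective (fun u : H =>
    Ideal.Quotient.mk (Ideal.span {t'} ^ (n + N)) ⟨t ^ n * u, hmul u u.2⟩) fun u w huw => ?_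
  rw [Ideal.Quotient.eq, Ideal.span_singleton_pow, Ideal.mem_span_singleton] at huw
  obtain ⟨y, hy⟩ := huw
  have hy' : t ^ n * u - t ^ n * w = t ^ (n + N) * y := congrArg Subtype.val hy
  have hsub : (u - w : L) = t ^ N * y := by
    refine mul_left_cancel₀ (pow_ne_zero n ht0) ?_
    rw [mul_sub, hy', pow_add, mul_assoc]
  refine Subtype.ext (sub_eq_zero.mp (hsmall _ (sub_mem u.2 w.2) ?_))
  rw [hsub, _root_.map_mul, map_pow]
  exact mul_le_of_le_one_right' ((hmemS _).mp y.2)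

end FunctionFields

/-! ### Arithmetic of the ring `A` -/

/-- Valuation rings are integrally closed, and `A` is an intersection of them. -/
theorem isIntegrallyClosedIn_regularRing {k F : Type*} [Field k] [Field F] [Algebra k F]
    (P : Place k F) : IsIntegrallyClosedIn (regularRing P) F := by
  refine (isIntegrallyClosedIn_iff (R := regularRing P) (A := F)).mpr
    ⟨Subtype.val_injective, fun {x} hx => ?_⟩
  refine ⟨⟨x, fun Q hQ => ?_⟩, rfl⟩
  obtain ⟨p, hp, hpx⟩ := hx
  have : IsIntegrallyClosedIn Q.valRing.toSubring F :=
    inferInstanceAs (IsIntegrallyClosedIn Q.valRing F)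
  refine (Subring.isIntegrallyClosedIn_iff (S := Q.valRing.toSubring)).mp this ?_
  let i : regularRing P →+* Q.valRing.toSubring :=
    (regularRing P).val.toRingHom.codRestrict _ fun y => y.2 Q hQ
  exact ⟨p.map i, hp.map i, by rwa [eval₂_map]⟩

theorem natCard_eq_card_pow_finrank {k V : Type*} [Field k] [Fintype k] [AddCommGroup V]
    [Module k V] [Module.Finite k V] : Nat.card V = Fintype.card k ^ Module.finrank k V := by
  rw [Module.natCard_eq_pow_finrank (K := k), Nat.card_eq_fintype_card]

theorem algebraMap_coe_injective {k F : Type*} [Field k] [Field F] [Algebra k F] (P : Place k F)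
    (K : Type*) [Field K] [Algebra F K] :
    Function.Injective fun a : regularRing P => algebraMap F K (a : F) :=
  (algebraMap F K).injective.comp Subtype.val_injective

namespace DrinfeldModule

variable {k F : Type*} [Field k] [Fintype k] [Field F] [Algebra k F] {P : Place k F}
  {K : Type*} [Field K] [Algebra F K] (ρ : DrinfeldModule P K)

theorem coeff_zero (a : regularRing P) : (ρ.toPoly a).coeff 0 = 0 := by
  by_contra h
  obtain ⟨i, hi⟩ := ρ.linear a 0 h
  exact pow_ne_zero i Fintype.card_ne_zero hi.symm

variable {ρ}

theorem toPoly_ne_zero (hρ : ρ.IsRankOne) {a : regularRing P} (ha : a ≠ 0) : ρ.toPoly a ≠ 0 := by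
  intro h
  have := hρ a ha
  rw [h, natDegree_zero] at this
  exact pow_ne_zero _ Fintype.card_ne_zero this.symm

theorem toPoly_eq_C_mul_X_of_deg_eq_zero (hρ : ρ.IsRankOne) {a : regularRing P} (ha : a ≠ 0) (hdeg : deg a = 0) :
    ρ.toPoly a = C (algebraMap F K (a : F)) * X := by
  have h := hρ a ha
  rw [hdeg, pow_zero] at h
  rw [eq_X_add_C_of_natDegree_le_one h.le, ρ.coeff_zero, ρ.coeff_one, C_0, add_zero]

theorem exists_two_le_natDegree (hρ : ρ.IsRankOne) : ∃ t : regularRing P, t ≠ 0 ∧ 2 ≤ (ρ.toPoly t).natDegree := by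
  obtain ⟨t, ht⟩ := ρ.nontrivial
  have ht0 : t ≠ 0 := by
    rintro rfl
    exact ht (by rw [ρ.toPoly_zero]; simp)
  have hdeg : deg t ≠ 0 := fun h => ht (toPoly_eq_C_mul_X_of_deg_eq_zero hρ ht0 h)
  refine ⟨t, ht0, ?_⟩
  rw [hρ t ht0]
  exact Fintype.one_lt_card.trans_le (Nat.le_self_pow hdeg _)

/-- Since `finrank` is also zero in infinite dimension, this is not immediate. Rank one gives `ρ_a =
a X`; it commutes with some `ρ_t` of degree `D ≥ 2`, and comparing leading coefficients gives `a = a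
^ D`, so `a` is a root of unity. -/
theorem isUnit_of_deg_eq_zero (hρ : ρ.IsRankOne) {a : regularRing P} (ha : a ≠ 0) (hdeg : deg a = 0) : IsUnit a := by
  obtain ⟨t, -, ht⟩ := exists_two_le_natDegree hρ
  have hcomp : (ρ.toPoly a).comp (ρ.toPoly t) = (ρ.toPoly t).comp (ρ.toPoly a) := by
    rw [← ρ.map_mul, ← ρ.map_mul, mul_comm]
  have hcoeff := congr(($hcomp).coeff (ρ.toPoly t).natDegree)
  rw [toPoly_eq_C_mul_X_of_deg_eq_zero hρ ha hdeg, mul_comp, C_comp, X_comp, coeff_C_mul,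
    comp_C_mul_X_coeff, mul_comm] at hcoeff
  have hlead : (ρ.toPoly t).coeff (ρ.toPoly t).natDegree ≠ 0 := fun h => by
    rw [leadingCoeff_eq_zero.mp h] at ht
    simp at ht
  have hpow := mul_left_cancel₀ hlead hcoeff
  have ha' : a = a ^ (ρ.toPoly t).natDegree := algebraMap_coe_injective P K (by
    simpa using hpow)
  obtain ⟨D, hD⟩ := Nat.exists_eq_add_of_le' ht
  rw [hD, pow_succ'] at ha'
  exact IsUnit.of_pow_eq_one (mul_left_cancel₀ ha ((mul_one a).trans ha')).symm (Nat.succ_ne_zero D)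

theorem finite_quotient_span (hρ : ρ.IsRankOne) {a : regularRing P} (ha : a ≠ 0) :
    Module.Finite k (regularRing P ⧸ Ideal.span {a}) := by
  by_cases hdeg : deg a = 0
  · have := Ideal.Quotient.subsingleton_iff.mpr
      (Ideal.span_singleton_eq_top.mpr (isUnit_of_deg_eq_zero hρ ha hdeg))
    infer_instance
  · have : Module.Free k (regularRing P ⧸ Ideal.span {a}) := Module.Free.of_divisionRing _ _
    exact Module.finite_of_finrank_pos (Nat.pos_of_ne_zero hdeg)

theorem card_quotient_span (hρ : ρ.IsRankOne) {a : regularRing P} (ha : a ≠ 0) :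
    Nat.card (regularRing P ⧸ Ideal.span {a}) = Fintype.card k ^ deg a := by
  have := finite_quotient_span hρ ha
  exact natCard_eq_card_pow_finrank

/-- Every nonzero ideal contains some `aA` of finite index, so it is finitely generated, and if
prime it is maximal. -/
theorem isDedekindDomain_regularRing (hρ : ρ.IsRankOne) : IsDedekindDomain (regularRing P) := by
  have hfin : ∀ I : Ideal (regularRing P), I ≠ ⊥ → Finite (regularRing P ⧸ I) := fun I hI => by
    obtain ⟨a, haI, ha⟩ := Submodule.exists_mem_ne_zero_of_ne_bot hI
    have := finite_quotient_span hρ ha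
    have : Finite (regularRing P ⧸ Ideal.span {a}) := Module.finite_of_finite k
    exact Finite.of_surjective _ (Ideal.Quotient.factor_surjective
      ((Ideal.span_singleton_le_iff_mem I).mpr haI))
  have hnoeth : IsNoetherianRing (regularRing P) := by
    refine (isNoetherianRing_iff_ideal_fg _).mpr fun I => ?_
    by_cases hI : I = ⊥
    · exact hI ▸ Submodule.fg_bot
    obtain ⟨a, haI, ha⟩ := Submodule.exists_mem_ne_zero_of_ne_bot hI
    have := hfin (Ideal.span {a}) (by simpa using ha)
    refine Submodule.fg_of_fg_map_of_fg_inf_ker (Submodule.mkQ (Ideal.span {a})) ?_ ?_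
    · exact Submodule.fg_def.mpr ⟨_, Set.toFinite _, Submodule.span_eq _⟩
    · rw [Submodule.ker_mkQ, inf_eq_right.mpr ((Ideal.span_singleton_le_iff_mem I).mpr haI)]
      exact Submodule.fg_span_singleton a
  have hdim : Ring.DimensionLEOne (regularRing P) := ⟨fun {p} hp hprime => by
    have := hfin p hp
    exact Ideal.Quotient.maximal_of_isField _ (Finite.isField_of_domain _)⟩
  have hic : IsIntegrallyClosed (regularRing P) :=
    have := isIntegrallyClosedIn_regularRing P
    .of_isIntegrallyClosedIn _ F
  have : IsDedekindRing (regularRing P) := { hnoeth, hdim, hic with }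
  exact {}

theorem isPrincipalIdealRing_regularRing (hρ : ρ.IsRankOne) (hA : Nat.card (ClassGroup (regularRing P)) = 1) :
    IsPrincipalIdealRing (regularRing P) := by
  have := isDedekindDomain_regularRing hρ
  have : Finite (ClassGroup (regularRing P)) := Nat.finite_of_card_ne_zero (by omega)
  have := Fintype.ofFinite (ClassGroup (regularRing P))
  exact card_classGroup_eq_one_iff.mp (by rw [← Nat.card_eq_fintype_card, hA])

/-- A nonzero algebraic element divides a nonzero constant, so it is a unit, and `ρ` sends it to a
polynomial of degree one. -/
theorem exists_transcendental (hρ : ρ.IsRankOne) :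
    ∃ t : regularRing P, Transcendental k (t : F) ∧ 2 ≤ (ρ.toPoly t).natDegree := by
  obtain ⟨t, ht0, ht⟩ := exists_two_le_natDegree hρ
  refine ⟨t, fun halg => ?_, ht⟩
  have halg' : IsAlgebraic k t :=
    (isAlgebraic_algHom_iff (regularRing P).val Subtype.val_injective).mp halg
  obtain ⟨r, hr, hdvd⟩ := halg'.exists_nonzero_dvd (mem_nonZeroDivisors_of_ne_zero ht0)
  have hu : IsUnit t := isUnit_of_dvd_unit hdvd ((Ne.isUnit hr).map _)
  have hdeg : deg t = 0 := by
    have := Ideal.Quotient.subsingleton_iff.mpr (Ideal.span_singleton_eq_top.mpr hu)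
    exact Module.finrank_zero_of_subsingleton
  rw [hρ t ht0, hdeg] at ht
  simp at ht

end DrinfeldModule

/-! ### Kernels `ρ[a]` and the torsion of `ρ` -/

namespace DrinfeldModule

variable {k F : Type*} [Field k] [Fintype k] [Field F] [Algebra k F] {P : Place k F}
  {K : Type*} [Field K] [Algebra F K] {ρ : DrinfeldModule P K}

theorem finite_kernel (hρ : ρ.IsRankOne) (Ω : Type*) [Field Ω] [Algebra K Ω] {a : regularRing P}
    (ha : a ≠ 0) : (ρ.kernel Ω a).Finite := by
  refine ((ρ.toPoly a).rootSet_finite Ω).subset fun u hu => ?_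
  exact (mem_rootSet_of_ne (toPoly_ne_zero hρ ha)).mpr hu

theorem ncard_kernel_le (hρ : ρ.IsRankOne) (Ω : Type*) [Field Ω] [Algebra K Ω] {a : regularRing P}
    (ha : a ≠ 0) : (ρ.kernel Ω a).ncard ≤ Fintype.card k ^ deg a := by
  have hsub : ρ.kernel Ω a ⊆ (ρ.toPoly a).rootSet Ω := fun u hu =>
    (mem_rootSet_of_ne (toPoly_ne_zero hρ ha)).mpr hu
  rw [← hρ a ha]
  exact (Set.ncard_le_ncard hsub ((ρ.toPoly a).rootSet_finite Ω)).trans (ncard_rootSet_le _ _)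

variable {L : Type*} [Field L] [Algebra K L]

theorem mem_torsion_iff {u : ρ.Points L} :
    u ∈ Submodule.torsion (regularRing P) (ρ.Points L) ↔ (show L from u) ∈ ρ.torsion L := by
  rw [Submodule.mem_torsion_iff]
  constructor
  · rintro ⟨a, ha⟩
    exact ⟨a, nonZeroDivisors.coe_ne_zero a, ha⟩
  · rintro ⟨a, ha, hu⟩
    exact ⟨⟨a, mem_nonZeroDivisors_of_ne_zero ha⟩, hu⟩

theorem algebraMap_smul_mem_kernel {a : regularRing P} {u : ρ.Points L} (hu : a • u = 0) :
    algebraMap L (AlgebraicClosure L) (show L from u) ∈ ρ.kernel (AlgebraicClosure L) a := by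
  exact (aeval_algebraMap_apply (AlgebraicClosure L) (show L from u) (ρ.toPoly a)).trans
    ((congrArg (algebraMap L (AlgebraicClosure L)) hu).trans (_root_.map_zero _))

theorem eval_map_mem_kernel (t : regularRing P) {a : regularRing P} {u : L}
    (hu : u ∈ ρ.kernel L a) : ((ρ.toPoly t).map (algebraMap K L)).eval u ∈ ρ.kernel L a := by
  have h : aeval u (ρ.toPoly a) = 0 := hu
  change aeval _ (ρ.toPoly a) = 0
  rw [eval_map_algebraMap, ← aeval_comp, ← ρ.map_mul, mul_comm, ρ.map_mul, aeval_comp, h,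
    ρ.aeval_zero']

/-- The torsion of a Drinfeld module over a function field is finite. -/
theorem finite_torsion [Algebra (RatFunc k) F] [IsScalarTower k (RatFunc k) F] [FunctionField k F]
    [FiniteDimensional F K] [FiniteDimensional K L] (hρ : ρ.IsRankOne) :
    Finite (Submodule.torsion (regularRing P) (ρ.Points L)) := by
  let : Algebra F L := ((algebraMap K L).comp (algebraMap F K)).toAlgebra
  have : IsScalarTower F K L := .of_algebraMap_eq' rfl
  have : FiniteDimensional F L := .trans F K L
  let : Algebra (RatFunc k) L := ((algebraMap F L).comp (algebraMap (RatFunc k) F)).toAlgebra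
  have : IsScalarTower (RatFunc k) F L := .of_algebraMap_eq' rfl
  have : FiniteDimensional (RatFunc k) L := .trans (RatFunc k) F L
  let : Algebra k L := ((algebraMap F L).comp (algebraMap k F)).toAlgebra
  have : IsScalarTower k F L := .of_algebraMap_eq' rfl
  have : IsScalarTower k (RatFunc k) L := .of_algebraMap_eq fun c => by
    rw [IsScalarTower.algebraMap_apply (RatFunc k) F L, ← IsScalarTower.algebraMap_apply k _ F,
      ← IsScalarTower.algebraMap_apply]
  obtain ⟨t, htr, ht⟩ := exists_transcendental hρ
  have htr' : Transcendental k (algebraMap F L t) :=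
    (transcendental_algebraMap_iff (algebraMap F L).injective).mpr htr
  refine finite_of_finite_orbits htr' (f := (ρ.toPoly t).map (algebraMap K L))
    (by rwa [natDegree_map]) (by rw [coeff_map, ρ.coeff_zero, _root_.map_zero])
    (by rw [coeff_map, ρ.coeff_one]; rfl)
    (Submodule.torsion (regularRing P) (ρ.Points L)).toAddSubgroup fun u hu => ?_
  obtain ⟨a, ha, hau⟩ := mem_torsion_iff.mp hu
  -- As `A` is commutative, the orbit of a point of `ρ[a]` under `ρ_t` stays in `ρ[a]`.
  refine (finite_kernel hρ L ha).subset ?_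
  rintro _ ⟨n, rfl⟩
  dsimp only
  induction n with
  | zero => exact hau
  | succ n ih =>
    rw [Function.iterate_succ_apply']
    exact eval_map_mem_kernel t ih

/-- A point with annihilator `aA` generates `ρ[a]`. -/
theorem isGenerator_of_smul_eq_zero_iff (hρ : ρ.IsRankOne) {a : regularRing P} (ha : a ≠ 0)
    {x : ρ.Points L} (hx : ∀ c : regularRing P, c • x = 0 ↔ a ∣ c) : ρ.IsGenerator L a x := by
  set R := Set.range fun c : regularRing P =>
    algebraMap L (AlgebraicClosure L) (show L from c • x)
  have hsub : R ⊆ ρ.kernel (AlgebraicClosure L) a := by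
    rintro _ ⟨c, rfl⟩
    refine algebraMap_smul_mem_kernel ?_
    rw [smul_comm, (hx a).mpr dvd_rfl, smul_zero]
  have hfin := finite_kernel hρ (AlgebraicClosure L) ha
  -- Counting: the orbit contains a copy of `A/aA`, which has `q ^ deg a` elements, at least as many
  -- as `ρ[a]`.
  refine (Set.eq_of_subset_of_ncard_le hsub ?_ hfin).symm
  refine (ncard_kernel_le hρ _ ha).trans ?_
  rw [← card_quotient_span hρ ha, ← Nat.card_coe_set_eq]
  have : Finite R := hfin.subset hsub
  refine Nat.card_le_card_of_injective (fun c : regularRing P ⧸ Ideal.span {a} =>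
    (⟨_, Set.mem_range_self c.out⟩ : R)) fun c d hcd => ?_
  have hcd' : c.out • x = d.out • x :=
    (algebraMap L (AlgebraicClosure L)).injective (congrArg Subtype.val hcd)
  rw [← Ideal.Quotient.mk_out c, ← Ideal.Quotient.mk_out d, Ideal.Quotient.eq,
    Ideal.mem_span_singleton, ← hx, sub_smul, hcd', sub_self]

/-- Over a principal ideal domain a finite torsion module `μ(L)` is some `ρ[a]`, and is cyclic. -/
theorem exists_generator_torsion [IsPrincipalIdealRing (regularRing P)] (hρ : ρ.IsRankOne)
    [Finite (Submodule.torsion (regularRing P) (ρ.Points L))] :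
    ∃ a : regularRing P, a ≠ 0 ∧ ρ.TorsionEqKernel L a ∧ ∃ x : ρ.Points L,
      (∀ c : regularRing P, c • x = 0 ↔ a ∣ c) ∧
      ∀ u ∈ ρ.torsion L, ∃ c : regularRing P, u = c • x := by
  set M := Submodule.torsion (regularRing P) (ρ.Points L)
  have : Module.Finite (regularRing P) M := .of_finite
  -- Over a PID a finitely generated module has an element whose annihilator is that of the module.
  obtain ⟨⟨x, hxM⟩, hx⟩ :=
    Module.exists_ker_toSpanSingleton_eq_annihilator (R := regularRing P) (M := M)
  obtain ⟨a, ha⟩ := IsPrincipalIdealRing.principal (Module.annihilator (regularRing P) M)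
  have hxa : ∀ c : regularRing P, c • x = 0 ↔ a ∣ c := fun c => by
    rw [← Ideal.mem_span_singleton]
    change _ ↔ c ∈ Submodule.span _ {a}
    rw [← ha, ← hx, LinearMap.mem_ker, LinearMap.toSpanSingleton_apply, Subtype.ext_iff]
    rfl
  have ha0 : a ≠ 0 := by
    obtain ⟨b, hb, hbx⟩ := mem_torsion_iff.mp hxM
    have := (hxa b).mp hbx
    exact ne_zero_of_dvd_ne_zero hb this
  have hgen := isGenerator_of_smul_eq_zero_iff hρ ha0 hxa
  have haM : ∀ u ∈ ρ.torsion L, a • (show ρ.Points L from u) = 0 := fun u hu => by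
    have hmem : a ∈ Module.annihilator (regularRing P) M :=
      ha ▸ Submodule.mem_span_singleton_self a
    exact congrArg Subtype.val (Module.mem_annihilator.mp hmem ⟨u, mem_torsion_iff.mpr hu⟩)
  have hcyc : ∀ u ∈ ρ.torsion L, ∃ c : regularRing P, u = c • x := fun u hu => by
    have h := algebraMap_smul_mem_kernel (haM u hu)
    rw [hgen] at h
    obtain ⟨c, hc⟩ := h
    exact ⟨c, ((algebraMap L (AlgebraicClosure L)).injective hc).symm⟩
  refine ⟨a, ha0, Set.Subset.antisymm ?_ ?_, x, hxa, hcyc⟩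
  · rintro _ ⟨u, hu, rfl⟩
    exact algebraMap_smul_mem_kernel (haM u hu)
  · rw [hgen]
    rintro _ ⟨c, rfl⟩
    exact ⟨_, mem_torsion_iff.mp (M.smul_mem c hxM), rfl⟩

end DrinfeldModule

/-! ### Two auxiliary facts on `p`-groups and principal ideal domains -/

/-- A group of order `p ^ m` is generated by `m` elements. -/
theorem exists_finset_closure_eq_top {G : Type*} [Group G] {p m : ℕ} (hp : p.Prime)
    (hG : Nat.card G = p ^ m) :
    ∃ S : Finset G, Subgroup.closure (S : Set G) = ⊤ ∧ S.card ≤ m := by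
  classical
  have hfin : Finite G := Nat.finite_of_card_ne_zero (hG ▸ pow_ne_zero m hp.ne_zero)
  -- Here `p ^ j` bounds the index of `H`. Adjoining an element outside `H` multiplies the order by
  -- at least `p`, so `j` elements suffice.
  have key : ∀ (j : ℕ) (H : Subgroup G), Nat.card G ≤ Nat.card H * p ^ j →
      ∃ S : Finset G, H ⊔ Subgroup.closure (S : Set G) = ⊤ ∧ S.card ≤ j := by
    intro j
    induction j with
    | zero =>
      intro H hH
      rw [pow_zero, mul_one] at hH
      exact ⟨∅, by simp [Subgroup.eq_top_of_le_card H hH], by simp⟩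
    | succ j ih =>
      intro H hH
      by_cases htop : H = ⊤
      · exact ⟨∅, by simp [htop], by simp⟩
      obtain ⟨g, hg⟩ : ∃ g, g ∉ H := by
        by_contra! h
        exact htop ((Subgroup.eq_top_iff' H).mpr h)
      set H' := H ⊔ Subgroup.closure {g}
      have hle : H ≤ H' := le_sup_left
      have hcard : Nat.card H * p ≤ Nat.card H' := by
        obtain ⟨d, hd⟩ := Subgroup.card_dvd_of_le hle
        have hd1 : d ≠ 1 := by
          rintro rfl
          have heq : H = H' := Subgroup.eq_of_le_of_card_ge hle (by omega)
          exact hg (heq ▸ (le_sup_right : _ ≤ H') (Subgroup.subset_closure rfl))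
        have hdvd : d ∣ p ^ m := by
          rw [← hG]
          exact (Dvd.intro_left _ hd.symm).trans (Subgroup.card_subgroup_dvd_card H')
        obtain ⟨i, -, rfl⟩ := (Nat.dvd_prime_pow hp).mp hdvd
        rw [hd]
        refine Nat.mul_le_mul_left _ (Nat.le_self_pow ?_ p)
        rintro rfl
        exact hd1 (pow_zero p)
      obtain ⟨S, hS, hSc⟩ := ih H' (hH.trans (by
        rw [pow_succ', ← mul_assoc]
        exact Nat.mul_le_mul_right _ hcard))
      refine ⟨insert g S, ?_, (Finset.card_insert_le _ _).trans (Nat.succ_le_succ hSc)⟩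
      rw [Finset.coe_insert, Set.insert_eq, Subgroup.closure_union, ← sup_assoc]
      exact hS
  obtain ⟨S, hS, hSc⟩ := key m ⊥ (by simp [hG])
  exact ⟨S, by simpa using hS, hSc⟩

/-- In a principal ideal domain an element divisible by all the prime divisors of `a` has a power
divisible by `a`. -/
theorem exists_dvd_pow_of_forall_irreducible_dvd {R : Type*} [CommRing R] [IsDomain R]
    [IsPrincipalIdealRing R] {a b : R} (ha : a ≠ 0) (h : ∀ m, Irreducible m → m ∣ a → m ∣ b) :
    ∃ n, a ∣ b ^ n := by
  have hmem : b ∈ (Ideal.span {a}).radical := by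
    rw [Ideal.radical_eq_sInf, Ideal.mem_sInf]
    rintro I ⟨haI, hI⟩
    obtain ⟨m, rfl⟩ := (IsPrincipalIdealRing.principal I).principal
    change Ideal.span {a} ≤ Ideal.span {m} at haI
    change (Ideal.span {m}).IsPrime at hI
    rw [Ideal.span_singleton_le_span_singleton] at haI
    have hm : Prime m := (Ideal.span_singleton_prime (ne_zero_of_dvd_ne_zero ha haI)).mp hI
    exact Ideal.mem_span_singleton.mpr (h m hm.irreducible haI)
  obtain ⟨n, hn⟩ := hmem
  exact ⟨n, Ideal.mem_span_singleton.mp hn⟩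

/-! ### Galois action on torsion and the cogalois module -/

namespace DrinfeldModule

variable {k F : Type*} [Field k] [Fintype k] [Field F] [Algebra k F] {P : Place k F}
  {K : Type*} [Field K] [Algebra F K] {ρ : DrinfeldModule P K}
  {L : Type*} [Field L] [Algebra K L]

variable (ρ) in
/-- A `K`-automorphism of `L`, as an `A`-linear automorphism of the points of `ρ`. -/
def pointsMap (σ : L ≃ₐ[K] L) : ρ.Points L →ₗ[regularRing P] ρ.Points L where
  toFun u := σ (show L from u)
  map_add' u v := _root_.map_add σ (show L from u) v
  map_smul' a u := (aeval_algHom_apply σ (show L from u) (ρ.toPoly a)).symm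

theorem eq_one_of_forall_torsion (hL : IntermediateField.adjoin K (ρ.torsion L) = ⊤)
    {σ : L ≃ₐ[K] L} (hσ : ∀ u ∈ ρ.torsion L, σ u = u) : σ = 1 := by
  ext z
  have hz : z ∈ IntermediateField.adjoin K (ρ.torsion L) := hL ▸ IntermediateField.mem_top
  induction hz using IntermediateField.adjoin_induction with
  | mem x hx => exact hσ x hx
  | algebraMap x => exact σ.commutes x
  | add x y _ _ hx hy => rw [_root_.map_add, hx, hy]; rfl
  | inv x _ hx => rw [map_inv₀, hx]; rfl
  | mul x y _ _ hx hy => rw [_root_.map_mul, hx, hy]; rfl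

/-- An automorphism of a pure extension generated by torsion has `p`-power order. -/
theorem exists_pow_ringChar_eq_one [IsPrincipalIdealRing (regularRing P)] (hρ : ρ.IsRankOne)
    (hpure : ρ.IsPure L) (hL : IntermediateField.adjoin K (ρ.torsion L) = ⊤)
    {a : regularRing P} (ha : a ≠ 0) {x : ρ.Points L}
    (hx : ∀ c : regularRing P, c • x = 0 ↔ a ∣ c)
    (hgen : ∀ u ∈ ρ.torsion L, ∃ c : regularRing P, u = c • x) (σ : L ≃ₐ[K] L) :
    ∃ j : ℕ, σ ^ ringChar k ^ j = 1 := by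
  obtain ⟨c, hc⟩ := hgen (ρ.pointsMap σ x) ⟨a, ha, by
    change a • ρ.pointsMap σ x = 0
    rw [← map_smul, (hx a).mpr dvd_rfl, _root_.map_zero]⟩
  change ρ.pointsMap σ x = c • x at hc
  -- Writing `a = m b`, the point `b • x` has annihilator `mA` and so generates `ρ[m]`; purity
  -- places it in `K`, where `σ` fixes it.
  have hdvd : ∀ m, Irreducible m → m ∣ a → m ∣ c - 1 := by
    rintro m hm ⟨b, rfl⟩
    have hb : b ≠ 0 := right_ne_zero_of_mul ha
    obtain ⟨y, hy⟩ := hpure m hm (b • x) (isGenerator_of_smul_eq_zero_iff hρ hm.ne_zero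
      fun d => by rw [← mul_smul, hx, mul_dvd_mul_iff_right hb])
    have hfix : ρ.pointsMap σ (b • x) = b • x := by
      rw [← hy]
      exact σ.commutes y
    rw [map_smul, hc, ← sub_eq_zero, ← smul_sub] at hfix
    rw [← mul_dvd_mul_iff_right hb, ← hx, mul_comm, mul_smul, sub_smul, one_smul, hfix]
  obtain ⟨n, hn⟩ := exists_dvd_pow_of_forall_irreducible_dvd ha hdvd
  have hp : (ringChar k).Prime := CharP.char_is_prime k _
  have : Fact (ringChar k).Prime := ⟨hp⟩
  have : CharP (regularRing P) (ringChar k) :=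
    charP_of_injective_algebraMap (algebraMap k (regularRing P)).injective _
  obtain ⟨j, hj⟩ : ∃ j, n ≤ ringChar k ^ j := ⟨n, (Nat.lt_pow_self hp.one_lt).le⟩
  -- Frobenius: `(c - 1) ^ p ^ j = c ^ p ^ j - 1`.
  have hcp : a ∣ c ^ ringChar k ^ j - 1 := by
    have h := hn.trans (pow_dvd_pow (c - 1) hj)
    rwa [sub_pow_char_pow, one_pow] at h
  have hpow : ∀ i : ℕ, ρ.pointsMap (σ ^ i) x = c ^ i • x := fun i => by
    induction i with
    | zero => rw [pow_zero, pow_zero, one_smul]; rfl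
    | succ i ih =>
      have h : ρ.pointsMap (σ ^ (i + 1)) x = ρ.pointsMap (σ ^ i) (ρ.pointsMap σ x) := by
        rw [pow_succ]; rfl
      rw [h, hc, map_smul, ih, ← mul_smul, pow_succ']
  refine ⟨j, eq_one_of_forall_torsion hL fun u hu => ?_⟩
  obtain ⟨d, rfl⟩ := hgen u hu
  change ρ.pointsMap (σ ^ ringChar k ^ j) (d • x) = d • x
  rw [map_smul, hpow, ← sub_eq_zero, ← smul_sub]
  rw [← hx, sub_smul, one_smul] at hcp
  rw [hcp, smul_zero]

/-- This holds for any `a` with `μ(L) = ρ[a]`, not only for the annihilator found above, as the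
final bound requires. -/
theorem card_torsion_le (hρ : ρ.IsRankOne) {a : regularRing P} (ha : a ≠ 0)
    (h : ρ.TorsionEqKernel L a) :
    Finite (Submodule.torsion (regularRing P) (ρ.Points L)) ∧
      Nat.card (Submodule.torsion (regularRing P) (ρ.Points L)) ≤ Fintype.card k ^ deg a := by
  have hfin := finite_kernel hρ (AlgebraicClosure L) ha
  have : Finite (ρ.kernel (AlgebraicClosure L) a) := hfin
  let f : Submodule.torsion (regularRing P) (ρ.Points L) → ρ.kernel (AlgebraicClosure L) a :=
    fun u => ⟨algebraMap L (AlgebraicClosure L) u.1,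
      h ▸ Set.mem_image_of_mem _ (mem_torsion_iff.mp u.2)⟩
  have hf : Function.Injective f := fun u v huv =>
    Subtype.ext ((algebraMap L (AlgebraicClosure L)).injective (congrArg Subtype.val huv))
  refine ⟨.of_injective f hf, (Nat.card_le_card_of_injective f hf).trans ?_⟩
  rw [Nat.card_coe_set_eq]
  exact ncard_kernel_le hρ _ ha

/-- If `ρ_n(u) ∈ K` then `σ` fixes `ρ_n(u)`, so `ρ_n` kills the difference. -/
theorem pointsMap_sub_mem_torsion (σ : L ≃ₐ[K] L) {u : ρ.Points L} (hu : u ∈ ρ.drinT L) :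
    ρ.pointsMap σ u - u ∈ Submodule.torsion (regularRing P) (ρ.Points L) := by
  obtain ⟨n, hn, x, hx⟩ := hu
  refine mem_torsion_iff.mpr ⟨n, hn, ?_⟩
  change n • (ρ.pointsMap σ u - u) = 0
  rw [smul_sub, ← map_smul, sub_eq_zero]
  have hx' : n • u = algebraMap K L x := hx.symm
  rw [hx']
  exact σ.commutes x

theorem mem_base_of_closure_eq_top [FiniteDimensional K L] [IsGalois K L] {S : Set (L ≃ₐ[K] L)}
    (hS : Subgroup.closure S = ⊤) {u : ρ.Points L} (hu : ∀ σ ∈ S, ρ.pointsMap σ u = u) :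
    u ∈ ρ.base L := by
  refine (IsGalois.mem_range_algebraMap_iff_fixed (F := K) (show L from u)).mpr fun σ => ?_
  have hle : Subgroup.closure S ≤ MulAction.stabilizer (L ≃ₐ[K] L) (show L from u) :=
    (Subgroup.closure_le _).mpr fun σ hσ => hu σ hσ
  exact hle (hS ▸ Subgroup.mem_top σ)

/-- The cogalois module embeds into `μ(L) ^ S` for every generating set `S` of the Galois group. -/
theorem card_drincog_le [FiniteDimensional K L] [IsGalois K L]
    [Finite (Submodule.torsion (regularRing P) (ρ.Points L))] (S : Finset (L ≃ₐ[K] L))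
    (hS : Subgroup.closure (S : Set (L ≃ₐ[K] L)) = ⊤) :
    Finite (ρ.Drincog L) ∧ Nat.card (ρ.Drincog L) ≤
      Nat.card (Submodule.torsion (regularRing P) (ρ.Points L)) ^ S.card := by
  -- Chosen representatives are enough, since only injectivity is needed: equal values make the
  -- difference of representatives fixed by `S`, hence by the whole group, so it lies in `K`.
  let f : ρ.Drincog L → S → Submodule.torsion (regularRing P) (ρ.Points L) := fun u σ =>
    ⟨_, pointsMap_sub_mem_torsion σ.1 u.out.2⟩
  have hf : Function.Injective f := fun u v huv => by
    rw [← Quotient.out_eq u, ← Quotient.out_eq v]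
    refine (Submodule.Quotient.eq _).mpr (mem_base_of_closure_eq_top hS fun σ hσ => ?_)
    have h : ρ.pointsMap σ (u.out : ρ.Points L) - u.out = ρ.pointsMap σ (v.out : ρ.Points L) - v.out
      := congrArg Subtype.val (congrFun huv ⟨σ, hσ⟩)
    change ρ.pointsMap σ ((u.out : ρ.Points L) - v.out) = u.out - v.out
    rw [_root_.map_sub, sub_eq_sub_iff_sub_eq_sub.mp h]
  refine ⟨.of_injective f hf, (Nat.card_le_card_of_injective f hf).trans ?_⟩
  rw [Nat.card_fun, Nat.card_eq_fintype_card (α := S), Fintype.card_coe]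

end DrinfeldModule

end DrinfeldCogalois

theorem mainTheorem10 {k F : Type*} [Field k] [Fintype k] [Field F] [Algebra k F]
    [Algebra (RatFunc k) F] [IsScalarTower k (RatFunc k) F] [FunctionField k F]
    (P : DrinfeldCogalois.Place k F)
    (hA : Nat.card (ClassGroup (DrinfeldCogalois.regularRing P)) = 1)
    {K : Type*} [Field K] [Algebra F K] [FiniteDimensional F K]
    (ρ : DrinfeldCogalois.DrinfeldModule P K) (hρ : ρ.IsRankOne)
    {L : Type*} [Field L] [Algebra K L] [FiniteDimensional K L] [IsGalois K L]
    (hcor : ρ.IsCyclotomicCoradical L)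
    (hL : IntermediateField.adjoin K (ρ.torsion L) = ⊤) :
    (∃ a : DrinfeldCogalois.regularRing P, a ≠ 0 ∧ ρ.TorsionEqKernel L a) ∧
    (∃ m : ℕ, Nat.card (L ≃ₐ[K] L) = ringChar k ^ m) ∧
    ∀ (a : DrinfeldCogalois.regularRing P) (m : ℕ),
      a ≠ 0 → ρ.TorsionEqKernel L a → Nat.card (L ≃ₐ[K] L) = ringChar k ^ m →
        Finite (ρ.Drincog L) ∧
          Nat.card (ρ.Drincog L) ≤ Fintype.card k ^ (m * DrinfeldCogalois.deg a) := by
  have := DrinfeldCogalois.DrinfeldModule.isPrincipalIdealRing_regularRing hρ hA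
  have := DrinfeldCogalois.DrinfeldModule.finite_torsion (L := L) hρ
  have hp : (ringChar k).Prime := CharP.char_is_prime k _
  have : Fact (ringChar k).Prime := ⟨hp⟩
  obtain ⟨b, hb, hker, x, hx, hgen⟩ :=
    DrinfeldCogalois.DrinfeldModule.exists_generator_torsion (L := L) hρ
  refine ⟨⟨b, hb, hker⟩, IsPGroup.iff_card.mp fun σ =>
    DrinfeldCogalois.DrinfeldModule.exists_pow_ringChar_eq_one hρ hcor.2.2 hL hb hx hgen σ,
    fun a m ha hTK hm => ?_⟩
  obtain ⟨S, hS, hSm⟩ := DrinfeldCogalois.exists_finset_closure_eq_top hp hm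
  obtain ⟨hfin, hle⟩ := DrinfeldCogalois.DrinfeldModule.card_drincog_le (ρ := ρ) S hS
  refine ⟨hfin, hle.trans ?_⟩
  rw [mul_comm, pow_mul]
  refine (Nat.pow_le_pow_left
    (DrinfeldCogalois.DrinfeldModule.card_torsion_le hρ ha hTK).2 _).trans ?_
  exact Nat.pow_le_pow_right (pow_pos Fintype.card_pos _) hSm
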